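/- **Setting.** Let $\mathcal M=(\mathcal S,\mathcal A,P,r,\gamma)$ be a discounted Markov decision process with finite nonempty state and action spaces, transition probabilities $P(\cdot\,|\,s,a)$, rewards $r(s,a)\in[0,1]$ and discount factor $\gamma\in[0,1)$. Let $\Delta(\mathcal A)$ be the probability simplex, let $\zeta>0$, and let $\Delta_\zeta(\mathcal A)=\{x\in\mathbb R^{\mathcal A}: x\ge 0,\ 1-\zeta\le\sum_a x_a\le 1+\zeta\}$. For every state $s$ let $h_s:\mathbb R^{\mathcal A}\to\mathbb R\cup\{\infty\}$ be convex with $h_s(p)=\infty$ for all $p\notin\Delta_\zeta(\mathcal A)$, and let $\tau>0$. For a policy $\pi$ (with $\pi(\cdot\,|\,s)\in\Delta(\mathcal A)$) put $$V^\pi_\tau(s)=\mathbb E\Big[\sum_{t\ge 0}\gamma^t\big\{r(s_t,a_t)-\tau h_{s_t}(\pi(\cdot\,|\,s_t))\big\}\,\Big|\,s_0=s\Big],\qquad Q^\pi_\tau(s,a)=r(s,a)+\gamma\,\mathbb E_{s'\sim P(\cdot|s,a)}\big[V^\pi_\tau(s')\big],$$ where $a_t\sim\pi(\cdot\,|\,s_t)$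 and $s_{t+1}\sim P(\cdot\,|\,s_t,a_t)$. Let $V^\star_\tau(s)=\sup_\pi V^\pi_\tau(s)$ and $Q^\star_\tau(s,a)=r(s,a)+\gamma\,\mathbb E_{s'\sim P(\cdot|s,a)}[V^\star_\tau(s')]$; an optimal policy $\pi^\star_\tau$ is one that attains this supremum in all states simultaneously. Write $D_{h_s}(p,q;g)=h_s(p)-h_s(q)-\langle g,p-q\rangle$. **Approximate GPMD.** Fix a learning rate $\eta>0$ and error levels $\varepsilon_{\mathsf{eval}},\varepsilon_{\mathsf{opt}}$. Start from a policy $\pi^{(0)}$ and vectors $\hat\xi^{(0)}(s,\cdot)\in\partial h_s(\pi^{(0)}(\cdot\,|\,s))$ for all $s$. For $k=0,1,2,\dots$, write $V^{(k)}_\tau=V^{\pi^{(k)}}_\tau$ and $Q^{(k)}_\tau=Q^{\pi^{(k)}}_\tau$; one is given an estimate $\hat Q^{(k)}_\tau$ with $\|\hat Q^{(k)}_\tau-Q^{(k)}_\tau\|_\infty\le\varepsilon_{\mathsf{eval}}$; for every $s$ an oracle returns some $\pi^{(k+1)}(\cdot\,|\,s)\in\Delta(\mathcal A)$ with $$f^{(k)}_s\big(\pi^{(k+1)}(\cdot\,|\,s)\big)\le\min_{p\in\Delta(\mathcal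 A)}f^{(k)}_s(p)+\varepsilon_{\mathsf{opt}},\qquad f^{(k)}_s(p)=-\langle\hat Q^{(k)}_\tau(s,\cdot),p\rangle+\tau h_s(p)+\tfrac1\eta D_{h_s}\big(p,\pi^{(k)}(\cdot\,|\,s);\hat\xi^{(k)}(s,\cdot)\big)$$ (the minimum being read as an infimum if it is not attained); and one sets $$\hat\xi^{(k+1)}(s,a)=\tfrac1{1+\eta\tau}\hat\xi^{(k)}(s,a)+\tfrac{\eta}{1+\eta\tau}\hat Q^{(k)}_\tau(s,a).$$ **Theorem.** Let $\alpha=\frac1{1+\eta\tau}$, $C_1=\|Q^\star_\tau-Q^{(0)}_\tau\|_\infty+2\alpha\|Q^\star_\tau-\tau\hat\xi^{(0)}\|_\infty$ and $$C_2=\frac1{1-\gamma}\Big[\Big(2+\frac{2\gamma}{(1-\gamma)(1-\alpha)}\Big)\varepsilon_{\mathsf{eval}}+\Big(1+\frac{2\gamma}{(1-\gamma)(1-\alpha)}\Big)\varepsilon_{\mathsf{opt}}\Big].$$ Then for all $k\ge 0$ $$\|Q^\star_\tau-Q^{(k+1)}_\tau\|_\infty\le\gamma\big[(1-(1-\alpha)(1-\gamma))^kC_1+C_2\big],$$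 $$\|V^\star_\tau-V^{(k+1)}_\tau\|_\infty\le(\gamma+2)\big[(1-(1-\alpha)(1-\gamma))^kC_1+C_2\big]+(1-\alpha)\varepsilon_{\mathsf{opt}}.$$ If in addition, for every $s$, $h_s$ is $1$-strongly convex with respect to the $\ell_1$ norm on $\Delta(\mathcal A)$, then for all $k\ge0$ both bounds hold with $C_2$ replaced by $$C_3=\frac1{1-\gamma}\Big[\Big(2+\frac{\varepsilon_{\mathsf{eval}}\gamma}{\tau(1-\gamma)}\Big)\varepsilon_{\mathsf{eval}}+\Big(1+\frac{4\gamma}{(1-\gamma)(1-\alpha)}\Big)\varepsilon_{\mathsf{opt}}\Big],$$ and, for every optimal policy $\pi^\star_\tau$ and every state $s$, $$\big\|\pi^\star_\tau(\cdot\,|\,s)-\pi^{(k+1)}(\cdot\,|\,s)\big\|_1\le\tau^{-1}\big[(1-(1-\alpha)(1-\gamma))^kC_1+C_3\big]+\sqrt{\frac{2\eta\,\varepsilon_{\mathsf{opt}}}{1+\eta\tau}}.$$ -/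

import Mathlib

noncomputable section

namespace GPMD

variable {S A : Type*} [Fintype S] [Fintype A]

/-- A discounted Markov decision process with finite state space `S` and finite action space `A`:
`P s a s'` is the probability of moving to `s'` when action `a` is executed in state `s`. -/
structure MDP (S A : Type*) [Fintype S] where
  P : S → A → S → ℝ
  P_mem : ∀ s a, P s a ∈ stdSimplex ℝ S
  r : S → A → ℝ
  r_mem : ∀ s a, r s a ∈ Set.Icc (0 : ℝ) 1
  γ : ℝ
  γ_nonneg : 0 ≤ γ
  γ_lt_one : γ < 1

/-- `π s a` is the probability that the policy `π` selects action `a` in state `s`. -/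
def IsPolicy (π : S → A → ℝ) : Prop := ∀ s, π s ∈ stdSimplex ℝ A

/-- The `ζ`-neighbourhood of the probability simplex. -/
def simplexNhd (A : Type*) [Fintype A] (ζ : ℝ) : Set (A → ℝ) :=
  {x | (∀ a, 0 ≤ x a) ∧ 1 - ζ ≤ ∑ a, x a ∧ ∑ a, x a ≤ 1 + ζ}

/-- `h : ℝ^A → ℝ ∪ {∞}` is convex (its epigraph is convex), and infinite outside of the
`ζ`-neighbourhood of the probability simplex. -/
structure IsRegularizer (ζ : ℝ) (h : (A → ℝ) → EReal) : Prop where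
  ne_bot : ∀ p, h p ≠ ⊥
  convex : Convex ℝ {x : (A → ℝ) × ℝ | h x.1 ≤ (x.2 : EReal)}
  eq_top : ∀ p, p ∉ simplexNhd A ζ → h p = ⊤

/-- The `ℓ¹` norm on `ℝ^A`. -/
def l1norm (x : A → ℝ) : ℝ := ∑ a, |x a|

/-- `h` is `1`-strongly convex with respect to the `ℓ¹` norm on the probability simplex. -/
def IsStronglyConvexL1 (h : (A → ℝ) → EReal) : Prop :=
  ∀ p ∈ stdSimplex ℝ A, ∀ q ∈ stdSimplex ℝ A, ∀ t : ℝ, 0 < t → t < 1 →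
    h (t • p + (1 - t) • q) + ((t * (1 - t) / 2 * l1norm (p - q) ^ 2 : ℝ) : EReal)
      ≤ (t : EReal) * h p + ((1 - t : ℝ) : EReal) * h q

/-- The subdifferential of an extended-real-valued `h` at `q` (empty if `h q` is not finite). -/
def subdifferential (h : (A → ℝ) → EReal) (q : A → ℝ) : Set (A → ℝ) :=
  {g | h q ≠ ⊤ ∧ h q ≠ ⊥ ∧ ∀ p, h q + ((g ⬝ᵥ (p - q) : ℝ) : EReal) ≤ h p}

/-- The generalized Bregman divergence `D_h(p, q; g) = h p - h q - ⟨g, p - q⟩`. -/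
def bregman (h : (A → ℝ) → EReal) (p q g : A → ℝ) : EReal :=
  h p - h q - ((g ⬝ᵥ (p - q) : ℝ) : EReal)

/-- The objective `-⟨Q, p⟩ + τ h p + η⁻¹ D_h(p, q; g)` of the mirror descent subproblem. -/
def subObj (h : (A → ℝ) → EReal) (τ η : ℝ) (Q q g p : A → ℝ) : EReal :=
  ((-(Q ⬝ᵥ p) : ℝ) : EReal) + (τ : EReal) * h p + ((1 / η : ℝ) : EReal) * bregman h p q g

/-- `p` is a possible answer of the `ε`-approximate oracle for the subproblem: a probability
vector whose objective is at most the minimum over the simplex plus `ε`. -/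
def IsOracleOutput (h : (A → ℝ) → EReal) (τ η ε : ℝ) (Q q g p : A → ℝ) : Prop :=
  p ∈ stdSimplex ℝ A ∧
    ∀ p' ∈ stdSimplex ℝ A, subObj h τ η Q q g p ≤ subObj h τ η Q q g p' + (ε : EReal)

/-- A policy whose regularization cost is finite in every state. The other policies have value
`-∞` in every state from which some state of infinite cost is reached with positive
probability. -/
def Admissible (h : S → (A → ℝ) → EReal) (π : S → A → ℝ) : Prop :=
  IsPolicy π ∧ ∀ s, h s (π s) ≠ ⊤

/-- The state transition matrix under `π`; the entry `s, s'` of its `t`-th power is the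
probability that `s_t = s'` given `s_0 = s`. -/
def transition (M : MDP S A) (π : S → A → ℝ) : Matrix S S ℝ :=
  Matrix.of fun s s' => ∑ a, π s a * M.P s a s'

variable [DecidableEq S]

/-- The regularized value function of an admissible policy: the sum over `t` of `γ ^ t` times
the expectation of `r(s_t, a_t) - τ h_{s_t}(π(s_t))` given `s_0 = s`, where `s_t = s'` and
`a_t = a` has probability `(transition M π ^ t) s s' * π s' a`. -/
def V (M : MDP S A) (h : S → (A → ℝ) → EReal) (τ : ℝ) (π : S → A → ℝ) (s : S) : ℝ :=
  ∑' t : ℕ, M.γ ^ t * ∑ s', ∑ a,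
    (transition M π ^ t) s s' * π s' a * (M.r s' a - τ * (h s' (π s')).toReal)

/-- The regularized Q-function. -/
def Q (M : MDP S A) (h : S → (A → ℝ) → EReal) (τ : ℝ) (π : S → A → ℝ) (s : S) (a : A) : ℝ :=
  M.r s a + M.γ * ∑ s', M.P s a s' * V M h τ π s'

/-- The optimal regularized value function. Policies which are not admissible do not contribute
to the supremum, since some admissible policy exists wherever this is used. -/
def Vstar (M : MDP S A) (h : S → (A → ℝ) → EReal) (τ : ℝ) (s : S) : ℝ :=
  sSup {v | ∃ π, Admissible h π ∧ V M h τ π s = v}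

/-- The optimal regularized Q-function. -/
def Qstar (M : MDP S A) (h : S → (A → ℝ) → EReal) (τ : ℝ) (s : S) (a : A) : ℝ :=
  M.r s a + M.γ * ∑ s', M.P s a s' * Vstar M h τ s'

/-- `π` maximizes the regularized value in all states simultaneously. -/
def IsOptimal (M : MDP S A) (h : S → (A → ℝ) → EReal) (τ : ℝ) (π : S → A → ℝ) : Prop :=
  Admissible h π ∧ ∀ π', Admissible h π' → ∀ s, V M h τ π' s ≤ V M h τ π s

/-- `π k`, `ξ k`, `Qhat k` (`k = 0, 1, …`) are the policies, the surrogate subgradients and the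
estimated Q-functions of a run of approximate GPMD, with learning rate `η`, evaluation error
`εeval` (in `ℓ^∞`; the norm on `S → A → ℝ` is the sup norm) and subproblem error `εopt`. -/
structure IsApproxGPMD (M : MDP S A) (h : S → (A → ℝ) → EReal) (τ η εeval εopt : ℝ)
    (π ξ Qhat : ℕ → S → A → ℝ) : Prop where
  init_policy : IsPolicy (π 0)
  init_subgradient : ∀ s, ξ 0 s ∈ subdifferential (h s) (π 0 s)
  evaluation : ∀ k, ‖Qhat k - Q M h τ (π k)‖ ≤ εeval
  policy_update : ∀ k s,
    IsOracleOutput (h s) τ η εopt (Qhat k s) (π k s) (ξ k s) (π (k + 1) s)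
  subgradient_update : ∀ k s a,
    ξ (k + 1) s a = 1 / (1 + η * τ) * ξ k s a + η / (1 + η * τ) * Qhat k s a

/-- `α = 1 / (1 + η τ)`. -/
def alpha (τ η : ℝ) : ℝ := 1 / (1 + η * τ)

/-- The contraction rate `1 - (1 - α) (1 - γ)`. -/
def rate (M : MDP S A) (τ η : ℝ) : ℝ := 1 - (1 - alpha τ η) * (1 - M.γ)

/-- The initial error, for the initial policy `π₀` and the initial subgradients `ξ₀`. -/
def C₁ (M : MDP S A) (h : S → (A → ℝ) → EReal) (τ η : ℝ) (π₀ ξ₀ : S → A → ℝ) : ℝ :=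
  ‖Qstar M h τ - Q M h τ π₀‖ + 2 * alpha τ η * ‖Qstar M h τ - τ • ξ₀‖

/-- The error floor for convex regularizers. -/
def C₂ (γ τ η εeval εopt : ℝ) : ℝ :=
  1 / (1 - γ) * ((2 + 2 * γ / ((1 - γ) * (1 - alpha τ η))) * εeval
    + (1 + 2 * γ / ((1 - γ) * (1 - alpha τ η))) * εopt)

/-- The error floor for strongly convex regularizers. -/
def C₃ (γ τ η εeval εopt : ℝ) : ℝ :=
  1 / (1 - γ) * ((2 + εeval * γ / (τ * (1 - γ))) * εeval
    + (1 + 4 * γ / ((1 - γ) * (1 - alpha τ η))) * εopt)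

end GPMD

end

noncomputable section

namespace GPMD

variable {S A : Type*} [Fintype S] [Fintype A]

/-! Put δ = η α ε_opt. Up to a constant, the subproblem objective is (1/η + τ)(h_s(p) - ⟨ξ^{(k+1)},
p⟩), so an ε_opt-minimizer π^{(k+1)} has ξ^{(k+1)} as a δ-subgradient over the simplex
(`IsOracleOutput.isApproxSubgradient`).

Track x_k = ‖Q* - τ ξ^{(k)}‖ and an upper bound d_k of τ ξ^{(k)} - Q^{(k)}. Comparing π^{(k)} with
an arbitrary policy through the δ-subgradient gives V* - V^{(k)} ≤ y_k := x_k + d_k + (1-α) ε_opt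
(`Vstar_sub_V_le`), hence ‖Q* - Q^{(k)}‖ ≤ γ y_k. Since τ ξ^{(k+1)} averages τ ξ^{(k)} and the
estimate of Q^{(k)} with weights α and 1-α, x_{k+1} ≤ α x_k + (1-α)(γ y_k + ε_eval). If an update
costs at most κ in the Bellman inequality, it lowers the value by at most κ/(1-γ) (`le_V_add`), so
d_{k+1} = α d_k + (1-α) ε_eval + γκ/(1-γ) is admissible. Adding up, y contracts at rate α + (1-α)γ
up to a constant (`error_bound`).

For the Q and V bounds only κ depends on the convexity class: the gain of an update is a sum of two
Bregman remainders (`gain_eq`). They are almost nonnegative in general, and under strong convexity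
their quadratic growth absorbs the evaluation error. The policy bound compares the subgradients Q*/τ
at π* and ξ^{(k)} at π^{(k)} (`dist_le_of_approxSubgradient`). -/

/-! ### Policy evaluation and the Bellman operator. -/

lemma transition_mem_rowStochastic [DecidableEq S] (M : MDP S A) {π : S → A → ℝ}
    (hπ : IsPolicy π) : transition M π ∈ Matrix.rowStochastic ℝ S := by
  rw [Matrix.mem_rowStochastic_iff_sum]
  refine ⟨fun s s' => ?_, fun s => ?_⟩
  · exact Finset.sum_nonneg fun a _ => mul_nonneg ((hπ s).1 a) ((M.P_mem s a).1 s')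
  · simp only [transition, Matrix.of_apply]
    rw [Finset.sum_comm]
    simp_rw [← Finset.mul_sum, (M.P_mem s _).2, mul_one]
    exact (hπ s).2

/-- The expected one-step reward under `π`. -/
def policyReward (M : MDP S A) (h : S → (A → ℝ) → EReal) (τ : ℝ) (π : S → A → ℝ) (s : S) : ℝ :=
  π s ⬝ᵥ M.r s - τ * (h s (π s)).toReal

open Matrix in
lemma V_eq_tsum [DecidableEq S] (M : MDP S A) (h : S → (A → ℝ) → EReal) (τ : ℝ)
    {π : S → A → ℝ} (hπ : IsPolicy π) (s : S) :
    V M h τ π s = ∑' t : ℕ, M.γ ^ t * ((transition M π ^ t) *ᵥ policyReward M h τ π) s := by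
  unfold V
  refine tsum_congr fun t => ?_
  congr 1
  simp only [Matrix.mulVec, dotProduct, policyReward]
  refine Finset.sum_congr rfl fun s' _ => ?_
  simp_rw [mul_assoc, ← Finset.mul_sum, mul_sub, Finset.sum_sub_distrib, ← Finset.sum_mul]
  rw [(hπ s').2]
  ring

open Matrix in
lemma abs_rowStochastic_mulVec_le [DecidableEq S] {B : Matrix S S ℝ}
    (hB : B ∈ Matrix.rowStochastic ℝ S) (c : S → ℝ) (s : S) : |(B *ᵥ c) s| ≤ ‖c‖ := by
  rw [Matrix.mem_rowStochastic_iff_sum] at hB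
  calc |(B *ᵥ c) s| ≤ ∑ s', |B s s' * c s'| := Finset.abs_sum_le_sum_abs _ _
    _ ≤ ∑ s', B s s' * ‖c‖ := by
        refine Finset.sum_le_sum fun s' _ => ?_
        rw [abs_mul, abs_of_nonneg (hB.1 s s')]
        exact mul_le_mul_of_nonneg_left (norm_le_pi_norm c s') (hB.1 s s')
    _ = ‖c‖ := by rw [← Finset.sum_mul, hB.2, one_mul]

open Matrix in
lemma summable_discounted [DecidableEq S] (M : MDP S A) (h : S → (A → ℝ) → EReal) (τ : ℝ)
    {π : S → A → ℝ} (hπ : IsPolicy π) (s : S) :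
    Summable fun t : ℕ => M.γ ^ t * ((transition M π ^ t) *ᵥ policyReward M h τ π) s := by
  refine Summable.of_norm_bounded
    ((summable_geometric_of_lt_one M.γ_nonneg M.γ_lt_one).mul_right ‖policyReward M h τ π‖) ?_
  intro t
  rw [norm_mul, Real.norm_of_nonneg (pow_nonneg M.γ_nonneg t)]
  exact mul_le_mul_of_nonneg_left
    (abs_rowStochastic_mulVec_le (pow_mem (transition_mem_rowStochastic M hπ) t) _ s)
    (pow_nonneg M.γ_nonneg t)

/-- The Bellman operator of the policy `π`. -/
def bellman (M : MDP S A) (h : S → (A → ℝ) → EReal) (τ : ℝ) (π : S → A → ℝ) (W : S → ℝ)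
    (s : S) : ℝ :=
  π s ⬝ᵥ (fun a => M.r s a + M.γ * ∑ s', M.P s a s' * W s') - τ * (h s (π s)).toReal

open Matrix in
lemma bellman_eq (M : MDP S A) (h : S → (A → ℝ) → EReal) (τ : ℝ)
    (π : S → A → ℝ) (W : S → ℝ) (s : S) :
    bellman M h τ π W s = policyReward M h τ π s + M.γ * (transition M π *ᵥ W) s := by
  simp only [bellman, policyReward, Matrix.mulVec, dotProduct, transition, Matrix.of_apply,
    mul_add, Finset.sum_add_distrib]
  have : ∑ a, π s a * (M.γ * ∑ s', M.P s a s' * W s')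
      = M.γ * ∑ s', (∑ a, π s a * M.P s a s') * W s' := by
    simp_rw [Finset.sum_mul, Finset.mul_sum]
    rw [Finset.sum_comm]
    exact Finset.sum_congr rfl fun _ _ => Finset.sum_congr rfl fun _ _ => by ring
  rw [this]; ring

open Matrix in
-- Splitting off the term t = 0 leaves γ times the transition matrix applied to the same series.
lemma bellman_V [DecidableEq S] (M : MDP S A) (h : S → (A → ℝ) → EReal) (τ : ℝ)
    {π : S → A → ℝ} (hπ : IsPolicy π) (s : S) :
    bellman M h τ π (V M h τ π) s = V M h τ π s := by
  have hs := summable_discounted M h τ hπ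
  rw [bellman_eq, V_eq_tsum M h τ hπ s, (hs s).tsum_eq_zero_add]
  simp only [pow_zero, one_mul, Matrix.one_mulVec]
  congr 1
  have hsum : ∀ (B : Matrix S S ℝ) (c : S → ℝ), (B *ᵥ c) s = ∑ s', B s s' * c s' := fun _ _ => rfl
  rw [hsum]
  simp_rw [V_eq_tsum M h τ hπ, ← tsum_mul_left]
  rw [← Summable.tsum_finsetSum fun s' _ => (hs s').mul_left _, ← tsum_mul_left]
  refine tsum_congr fun t => ?_
  rw [pow_succ' (transition M π), ← Matrix.mulVec_mulVec, hsum, Finset.mul_sum, Finset.mul_sum]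
  exact Finset.sum_congr rfl fun _ _ => by ring

lemma V_eq [DecidableEq S] (M : MDP S A) (h : S → (A → ℝ) → EReal) (τ : ℝ)
    {π : S → A → ℝ} (hπ : IsPolicy π) (s : S) :
    V M h τ π s = π s ⬝ᵥ Q M h τ π s - τ * (h s (π s)).toReal :=
  (bellman_V M h τ hπ s).symm

open Matrix in
/-- A function that is almost a subsolution of the Bellman equation of `π` is almost below the
value function of `π`. -/
lemma le_V_add [DecidableEq S] (M : MDP S A) (h : S → (A → ℝ) → EReal) (τ : ℝ)
    {π : S → A → ℝ} (hπ : IsPolicy π) {W : S → ℝ} {κ : ℝ}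
    (hW : ∀ s, W s ≤ bellman M h τ π W s + κ) (s : S) :
    W s ≤ V M h τ π s + κ / (1 - M.γ) := by
  have : Nonempty S := ⟨s⟩
  have hγ := sub_pos.2 M.γ_lt_one
  -- At a state of maximal excess, averaging cannot increase the excess, so (1 - γ) times it is at
  -- most κ.
  obtain ⟨m, hm⟩ := Finite.exists_max fun s => W s - V M h τ π s
  have hT := Matrix.mem_rowStochastic_iff_sum.1 (transition_mem_rowStochastic M hπ)
  have h1 : (transition M π *ᵥ W) m - (transition M π *ᵥ V M h τ π) m ≤ W m - V M h τ π m := by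
    simp only [Matrix.mulVec, dotProduct]
    rw [← Finset.sum_sub_distrib]
    calc _ ≤ ∑ s', transition M π m s' * (W m - V M h τ π m) := by
          refine Finset.sum_le_sum fun s' _ => ?_
          rw [← mul_sub]
          exact mul_le_mul_of_nonneg_left (hm s') (hT.1 m s')
      _ = _ := by rw [← Finset.sum_mul, hT.2, one_mul]
  have h2 := hW m
  have h3 := bellman_V M h τ hπ m
  rw [bellman_eq] at h2 h3
  have h4 := mul_le_mul_of_nonneg_left h1 M.γ_nonneg
  have h5 : W m - V M h τ π m ≤ κ / (1 - M.γ) := by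
    rw [le_div_iff₀ hγ]; nlinarith
  linarith [hm s]

/-! ### Elementary estimates on the simplex. -/

lemma sum_mul_le_of_mem_stdSimplex {ι : Type*} [Fintype ι] {p : ι → ℝ} (hp : p ∈ stdSimplex ℝ ι)
    {f : ι → ℝ} {c : ℝ} (hf : ∀ i, f i ≤ c) : ∑ i, p i * f i ≤ c := by
  calc _ ≤ ∑ i, p i * c := Finset.sum_le_sum fun i _ => mul_le_mul_of_nonneg_left (hf i) (hp.1 i)
    _ = c := by rw [← Finset.sum_mul, hp.2, one_mul]

lemma abs_dotProduct_le (g x : A → ℝ) {c : ℝ} (hg : ∀ a, |g a| ≤ c) :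
    |g ⬝ᵥ x| ≤ c * l1norm x := by
  rw [l1norm, Finset.mul_sum]
  refine (Finset.abs_sum_le_sum_abs _ _).trans (Finset.sum_le_sum fun a _ => ?_)
  rw [abs_mul]
  exact mul_le_mul_of_nonneg_right (hg a) (abs_nonneg _)

lemma l1norm_nonneg (x : A → ℝ) : 0 ≤ l1norm x := Finset.sum_nonneg fun _ _ => abs_nonneg _

lemma l1norm_sub_comm (x y : A → ℝ) : l1norm (x - y) = l1norm (y - x) :=
  Finset.sum_congr rfl fun a _ => abs_sub_comm (x a) (y a)

lemma l1norm_sub_le_two {p q : A → ℝ} (hp : p ∈ stdSimplex ℝ A) (hq : q ∈ stdSimplex ℝ A) :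
    l1norm (p - q) ≤ 2 := by
  calc l1norm (p - q) ≤ ∑ a, (p a + q a) := by
        refine Finset.sum_le_sum fun a _ => ?_
        rw [Pi.sub_apply, abs_le]
        constructor <;> linarith [hp.1 a, hq.1 a]
    _ = 2 := by rw [Finset.sum_add_distrib, hp.2, hq.2]; norm_num

lemma abs_le_norm (f : S → A → ℝ) (s : S) (a : A) : |f s a| ≤ ‖f‖ :=
  (norm_le_pi_norm (f s) a).trans (norm_le_pi_norm f s)

/-! ### Approximate subgradients and the mirror descent subproblem. -/

/-- `g` is a `δ`-subgradient at `q` of the restriction of `h` to the probability simplex. -/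
def IsApproxSubgradient (h : (A → ℝ) → EReal) (δ : ℝ) (q g : A → ℝ) : Prop :=
  q ∈ stdSimplex ℝ A ∧ h q ≠ ⊤ ∧
    ∀ p ∈ stdSimplex ℝ A, h p ≠ ⊤ → (h q).toReal + g ⬝ᵥ (p - q) ≤ (h p).toReal + δ

lemma IsApproxSubgradient.mono {h : (A → ℝ) → EReal} {δ δ' : ℝ} {q g : A → ℝ}
    (H : IsApproxSubgradient h δ q g) (hδ : δ ≤ δ') : IsApproxSubgradient h δ' q g :=
  ⟨H.1, H.2.1, fun p hp hpt => (H.2.2 p hp hpt).trans (by linarith)⟩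

lemma isApproxSubgradient_of_mem_subdifferential {h : (A → ℝ) → EReal} {q g : A → ℝ}
    (hbot : ∀ p, h p ≠ ⊥) (hq : q ∈ stdSimplex ℝ A) (hg : g ∈ subdifferential h q) :
    IsApproxSubgradient h 0 q g := by
  refine ⟨hq, hg.1, fun p _ hpt => ?_⟩
  have := hg.2.2 p
  rw [← EReal.coe_toReal hpt (hbot p), ← EReal.coe_toReal hg.1 (hbot q)] at this
  rw [add_zero]
  exact_mod_cast this

lemma subObj_coe {h : (A → ℝ) → EReal} {τ η x y : ℝ} {Q q g p : A → ℝ}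
    (hp : h p = (x : EReal)) (hq : h q = (y : EReal)) :
    subObj h τ η Q q g p
      = ((-(Q ⬝ᵥ p) + τ * x + 1 / η * (x - y - g ⬝ᵥ (p - q)) : ℝ) : EReal) := by
  simp only [subObj, bregman, hp, hq]
  norm_cast

lemma subObj_top {h : (A → ℝ) → EReal} {τ η y : ℝ} (hτ : 0 < τ) (hη : 0 < η) {Q q g p : A → ℝ}
    (hp : h p = ⊤) (hq : h q = (y : EReal)) : subObj h τ η Q q g p = ⊤ := by
  simp only [subObj, bregman, hp, hq]
  rw [EReal.top_sub_coe, EReal.top_sub_coe, EReal.coe_mul_top_of_pos hτ,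
    EReal.coe_mul_top_of_pos (by positivity), EReal.coe_add_top, EReal.top_add_top]

/-- An approximate solution of the mirror descent subproblem has the updated vector as an
approximate subgradient. -/
lemma IsOracleOutput.isApproxSubgradient {h : (A → ℝ) → EReal} {τ η ε : ℝ} (hτ : 0 < τ)
    (hη : 0 < η) {Q q g p : A → ℝ} (hbot : ∀ p, h p ≠ ⊥) (hq : q ∈ stdSimplex ℝ A)
    (hqt : h q ≠ ⊤) (H : IsOracleOutput h τ η ε Q q g p) {g' : A → ℝ}
    (hg' : ∀ a, g' a = 1 / (1 + η * τ) * g a + η / (1 + η * τ) * Q a) :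
    0 ≤ ε ∧ IsApproxSubgradient h (η * alpha τ η * ε) p g' := by
  have hη1 : 0 < 1 + η * τ := by positivity
  have hqy := (EReal.coe_toReal hqt (hbot q)).symm
  have hpt : h p ≠ ⊤ := by
    intro hpt
    have := H.2 q hq
    rw [subObj_top hτ hη hpt hqy, subObj_coe hqy hqy, ← EReal.coe_add] at this
    exact EReal.coe_ne_top _ (top_le_iff.1 this)
  have hpx := (EReal.coe_toReal hpt (hbot p)).symm
  refine ⟨?_, H.1, hpt, fun p' hp' hpt' => ?_⟩
  -- Comparing the finite objective at `p` with itself forces ε ≥ 0.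
  · have := H.2 p H.1
    rw [subObj_coe hpx hqy, ← EReal.coe_add, EReal.coe_le_coe_iff] at this
    linarith
  · have hpx' := (EReal.coe_toReal hpt' (hbot p')).symm
    have := H.2 p' hp'
    rw [subObj_coe hpx hqy, subObj_coe hpx' hqy, ← EReal.coe_add, EReal.coe_le_coe_iff] at this
    have hg : ∀ v : A → ℝ, g' ⬝ᵥ v = 1 / (1 + η * τ) * (g ⬝ᵥ v) + η / (1 + η * τ) * (Q ⬝ᵥ v) := by
      intro v
      simp only [dotProduct, hg', add_mul, Finset.sum_add_distrib, Finset.mul_sum, mul_assoc]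
    simp only [dotProduct_sub] at this ⊢
    rw [hg, hg]
    -- The factor η α is the inverse of 1/η + τ, the total weight of `h` in the objective.
    have h2 := mul_le_mul_of_nonneg_left this (show 0 ≤ η * alpha τ η by unfold alpha; positivity)
    unfold alpha at *
    generalize g ⬝ᵥ p = a1 at *
    generalize g ⬝ᵥ p' = a2 at *
    generalize g ⬝ᵥ q = a3 at *
    generalize Q ⬝ᵥ p = a4 at *
    generalize Q ⬝ᵥ p' = a5 at *
    generalize (h p).toReal = x at *
    generalize (h p').toReal = x' at *
    generalize (h q).toReal = y at *
    rw [← sub_nonneg] at h2 ⊢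
    refine h2.trans_eq ?_
    field_simp
    ring

/-- Quadratic growth at approximate subgradients of strongly convex functions. -/
lemma IsApproxSubgradient.quadratic_growth {h : (A → ℝ) → EReal} {δ : ℝ} {q g p : A → ℝ}
    (hbot : ∀ p, h p ≠ ⊥) (hsc : IsStronglyConvexL1 h) (H : IsApproxSubgradient h δ q g)
    (hp : p ∈ stdSimplex ℝ A) (hpt : h p ≠ ⊤) {t : ℝ} (ht0 : 0 < t) (ht1 : t < 1) :
    (1 - t) / 2 * l1norm (p - q) ^ 2
      ≤ (h p).toReal - (h q).toReal - g ⬝ᵥ (p - q) + δ / t := by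
  obtain ⟨hq, hqt, Hsub⟩ := H
  have h1 := hsc p hp q hq t ht0 ht1
  have hm : t • p + (1 - t) • q ∈ stdSimplex ℝ A :=
    convex_stdSimplex ℝ A hp hq ht0.le (sub_nonneg.2 ht1.le) (by ring)
  rw [← EReal.coe_toReal hpt (hbot p), ← EReal.coe_toReal hqt (hbot q)] at h1
  have hmt : h (t • p + (1 - t) • q) ≠ ⊤ := by
    intro hmt
    rw [hmt, EReal.top_add_coe, ← EReal.coe_mul, ← EReal.coe_mul, ← EReal.coe_add] at h1
    exact EReal.coe_ne_top _ (top_le_iff.1 h1)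
  -- The subgradient inequality is tested at q + t (p - q) and combined with strong convexity;
  -- dividing by t turns δ into δ/t.
  have h2 := Hsub _ hm hmt
  rw [← EReal.coe_toReal hmt (hbot _)] at h1
  have h3 : (h (t • p + (1 - t) • q)).toReal + t * (1 - t) / 2 * l1norm (p - q) ^ 2
      ≤ t * (h p).toReal + (1 - t) * (h q).toReal := by exact_mod_cast h1
  have h4 : t • p + (1 - t) • q - q = t • (p - q) := by
    ext a; simp; ring
  rw [h4, dotProduct_smul, smul_eq_mul] at h2
  have h5 : 0 ≤ t * ((h p).toReal - (h q).toReal - g ⬝ᵥ (p - q) + δ / t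
      - (1 - t) / 2 * l1norm (p - q) ^ 2) := by
    have : t * (δ / t) = δ := by field_simp
    rw [mul_sub, mul_add, this]; linarith
  linarith [nonneg_of_mul_nonneg_right h5 ht0]

lemma alpha_pos {τ η : ℝ} (hτ : 0 < τ) (hη : 0 < η) : 0 < alpha τ η := by
  unfold alpha; positivity

lemma one_sub_alpha {τ η : ℝ} (hτ : 0 < τ) (hη : 0 < η) :
    1 - alpha τ η = τ * (η * alpha τ η) := by
  unfold alpha
  have : 0 < 1 + η * τ := by positivity
  field_simp
  ring

lemma one_sub_alpha_pos {τ η : ℝ} (hτ : 0 < τ) (hη : 0 < η) : 0 < 1 - alpha τ η := by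
  have := alpha_pos hτ hη
  rw [one_sub_alpha hτ hη]; positivity

lemma IsApproxSubgradient.le_toReal {h : (A → ℝ) → EReal} {δ : ℝ} {q g : A → ℝ}
    (H : IsApproxSubgradient h δ q g) {p : A → ℝ} (hp : p ∈ stdSimplex ℝ A) (hpt : h p ≠ ⊤) :
    (h q).toReal - ‖g‖ * 2 - δ ≤ (h p).toReal := by
  have h1 := H.2.2 p hp hpt
  have h2 := abs_le.1 (abs_dotProduct_le g (p - q) fun a => norm_le_pi_norm g a)
  have h3 := mul_le_mul_of_nonneg_left (l1norm_sub_le_two hp H.1) (norm_nonneg g)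
  linarith

/-! ### Suboptimality gaps and optimal policies. -/

/-- Regularizers with an approximate subgradient are bounded below, so that values are bounded
above. -/
lemma bddAbove_values [DecidableEq S] (M : MDP S A) {h : S → (A → ℝ) → EReal} {τ δ : ℝ}
    (hτ : 0 < τ) {q g : S → A → ℝ} (H : ∀ s, IsApproxSubgradient (h s) δ (q s) (g s)) (s : S) :
    BddAbove {v | ∃ π, Admissible h π ∧ V M h τ π s = v} := by
  have : Nonempty S := ⟨s⟩
  have hγ := sub_pos.2 M.γ_lt_one
  obtain ⟨n, hn⟩ := Finite.exists_min fun s => (h s (q s)).toReal - ‖g s‖ * 2 - δ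
  set b := (h n (q n)).toReal - ‖g n‖ * 2 - δ
  refine ⟨(1 - τ * b) / (1 - M.γ), ?_⟩
  rintro v ⟨π, hπ, rfl⟩
  -- At the best state, the Bellman equation gives V(m) ≤ 1 + γ V(m) - τ b.
  obtain ⟨m, hm⟩ := Finite.exists_max (V M h τ π)
  refine (hm s).trans ?_
  have h1 : π m ⬝ᵥ Q M h τ π m ≤ 1 + M.γ * V M h τ π m :=
    sum_mul_le_of_mem_stdSimplex (hπ.1 m) fun a => add_le_add (M.r_mem m a).2
      (mul_le_mul_of_nonneg_left (sum_mul_le_of_mem_stdSimplex (M.P_mem m a) hm) M.γ_nonneg)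
  have h2 := V_eq M h τ hπ.1 m
  have h3 := mul_le_mul_of_nonneg_left
    ((hn m).trans ((H m).le_toReal (hπ.1 m) (hπ.2 m))) hτ.le
  rw [le_div_iff₀ hγ]
  linarith

lemma V_le_Vstar [DecidableEq S] {M : MDP S A} {h : S → (A → ℝ) → EReal} {τ : ℝ}
    (hbdd : ∀ s, BddAbove {v | ∃ π, Admissible h π ∧ V M h τ π s = v}) {π : S → A → ℝ}
    (hπ : Admissible h π) (s : S) : V M h τ π s ≤ Vstar M h τ s :=
  le_csSup (hbdd s) ⟨π, hπ, rfl⟩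

lemma Qstar_sub_Q [DecidableEq S] (M : MDP S A) (h : S → (A → ℝ) → EReal) (τ : ℝ)
    (π : S → A → ℝ) (s : S) (a : A) : Qstar M h τ s a - Q M h τ π s a
      = M.γ * ∑ s', M.P s a s' * (Vstar M h τ s' - V M h τ π s') := by
  simp only [Qstar, Q, mul_sub, Finset.sum_sub_distrib]
  ring

lemma Q_le_Qstar [DecidableEq S] {M : MDP S A} {h : S → (A → ℝ) → EReal} {τ : ℝ}
    (hbdd : ∀ s, BddAbove {v | ∃ π, Admissible h π ∧ V M h τ π s = v}) {π : S → A → ℝ}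
    (hπ : Admissible h π) (s : S) (a : A) : Q M h τ π s a ≤ Qstar M h τ s a := by
  rw [← sub_nonneg, Qstar_sub_Q]
  exact mul_nonneg M.γ_nonneg (Finset.sum_nonneg fun s' _ =>
    mul_nonneg ((M.P_mem s a).1 s') (sub_nonneg.2 (V_le_Vstar hbdd hπ s')))

lemma dotProduct_le_dotProduct_add {p f g : A → ℝ} (hp : p ∈ stdSimplex ℝ A) {c : ℝ}
    (hfg : ∀ a, f a - g a ≤ c) : p ⬝ᵥ f ≤ p ⬝ᵥ g + c := by
  have := sum_mul_le_of_mem_stdSimplex hp hfg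
  rw [← sub_le_iff_le_add', ← dotProduct_sub]
  exact this

lemma norm_Qstar_sub_Q_le [DecidableEq S] [Nonempty S] {M : MDP S A} {h : S → (A → ℝ) → EReal}
    {τ : ℝ} (hbdd : ∀ s, BddAbove {v | ∃ π, Admissible h π ∧ V M h τ π s = v}) {π : S → A → ℝ}
    (hπ : Admissible h π) {B : ℝ} (hB : ∀ s, Vstar M h τ s - V M h τ π s ≤ B) :
    ‖Qstar M h τ - Q M h τ π‖ ≤ M.γ * B := by
  have hB0 : 0 ≤ B := by
    obtain ⟨s⟩ := ‹Nonempty S›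
    linarith [hB s, V_le_Vstar hbdd hπ s]
  have h0 := mul_nonneg M.γ_nonneg hB0
  refine (pi_norm_le_iff_of_nonneg h0).2 fun s => (pi_norm_le_iff_of_nonneg h0).2 fun a => ?_
  rw [Pi.sub_apply, Pi.sub_apply, Real.norm_of_nonneg (sub_nonneg.2 (Q_le_Qstar hbdd hπ s a)),
    Qstar_sub_Q]
  exact mul_le_mul_of_nonneg_left (sum_mul_le_of_mem_stdSimplex (M.P_mem s a) hB) M.γ_nonneg

lemma norm_Vstar_sub_V_le [DecidableEq S] [Nonempty S] {M : MDP S A} {h : S → (A → ℝ) → EReal}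
    {τ : ℝ} (hbdd : ∀ s, BddAbove {v | ∃ π, Admissible h π ∧ V M h τ π s = v}) {π : S → A → ℝ}
    (hπ : Admissible h π) {B : ℝ} (hB : ∀ s, Vstar M h τ s - V M h τ π s ≤ B) :
    ‖Vstar M h τ - V M h τ π‖ ≤ B := by
  refine (pi_norm_le_iff_of_nonempty _).2 fun s => ?_
  rw [Pi.sub_apply, Real.norm_of_nonneg (sub_nonneg.2 (V_le_Vstar hbdd hπ s))]
  exact hB s

/-- The suboptimality of a policy with approximate subgradients `ξ`, in terms of how well `τ ξ`
approximates the optimal Q-function and the Q-function of the policy. -/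
lemma Vstar_sub_V_le [DecidableEq S] {M : MDP S A} {h : S → (A → ℝ) → EReal} {τ δ d : ℝ}
    (hτ : 0 < τ) (hbdd : ∀ s, BddAbove {v | ∃ π, Admissible h π ∧ V M h τ π s = v})
    {π ξ : S → A → ℝ} (hπ : ∀ s, IsApproxSubgradient (h s) δ (π s) (ξ s))
    (hd : ∀ s a, τ * ξ s a - Q M h τ π s a ≤ d) (s : S) :
    Vstar M h τ s - V M h τ π s ≤ ‖Qstar M h τ - τ • ξ‖ + d + τ * δ := by
  have hadm : Admissible h π := ⟨fun s => (hπ s).1, fun s => (hπ s).2.1⟩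
  rw [sub_le_iff_le_add']
  -- The comparison is with every admissible policy, so neither an optimal policy nor the Bellman
  -- optimality equation is needed.
  refine csSup_le ⟨_, π, hadm, rfl⟩ ?_
  rintro v ⟨π', hπ', rfl⟩
  have h1 := V_eq M h τ hπ'.1 s
  have h2 : π' s ⬝ᵥ Q M h τ π' s ≤ π' s ⬝ᵥ Qstar M h τ s + 0 :=
    dotProduct_le_dotProduct_add (hπ'.1 s) fun a => sub_nonpos.2 (Q_le_Qstar hbdd hπ' s a)
  have h3 : π' s ⬝ᵥ Qstar M h τ s ≤ π' s ⬝ᵥ (τ • ξ s) + ‖Qstar M h τ - τ • ξ‖ :=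
    dotProduct_le_dotProduct_add (hπ'.1 s) fun a =>
      (le_abs_self _).trans (abs_le_norm (Qstar M h τ - τ • ξ) s a)
  have h4 := mul_le_mul_of_nonneg_left ((hπ s).2.2 _ (hπ'.1 s) (hπ'.2 s)) hτ.le
  have h5 : π s ⬝ᵥ (τ • ξ s) ≤ π s ⬝ᵥ Q M h τ π s + d :=
    dotProduct_le_dotProduct_add (hadm.1 s) (hd s)
  have h6 := V_eq M h τ hadm.1 s
  rw [dotProduct_smul, smul_eq_mul, dotProduct_comm _ (ξ s)] at h3 h5
  rw [dotProduct_sub] at h4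
  linarith

/-- An optimal policy is greedy with respect to the optimal Q-function. -/
lemma IsOptimal.greedy [DecidableEq S] {M : MDP S A} {h : S → (A → ℝ) → EReal} {τ : ℝ}
    {π : S → A → ℝ} (H : IsOptimal M h τ π) {s : S} {p : A → ℝ} (hp : p ∈ stdSimplex ℝ A)
    (hpt : h s p ≠ ⊤) : p ⬝ᵥ Qstar M h τ s - τ * (h s p).toReal
      ≤ π s ⬝ᵥ Qstar M h τ s - τ * (h s (π s)).toReal := by
  have hV : Vstar M h τ = V M h τ π := by
    funext s
    refine IsGreatest.csSup_eq ⟨⟨π, H.1, rfl⟩, ?_⟩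
    rintro v ⟨π', hπ', rfl⟩
    exact H.2 π' hπ' s
  have hQ : Qstar M h τ s = Q M h τ π s := by
    funext a; simp only [Qstar, Q, hV]
  rw [hQ, ← V_eq M h τ H.1.1 s]
  by_contra! hlt
  -- Policy improvement: switching to `p` at `s` alone lowers no value and strictly raises the one
  -- at `s`.
  let π' := Function.update π s p
  have hs : π' s = p := Function.update_self ..
  have hne : ∀ s', s' ≠ s → π' s' = π s' := fun s' hs' => Function.update_of_ne hs' ..
  have hπ' : Admissible h π' := by
    constructor <;> intro s' <;> by_cases hs' : s' = s
    · subst hs'; rwa [hs]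
    · rw [hne s' hs']; exact H.1.1 s'
    · subst hs'; rwa [hs]
    · rw [hne s' hs']; exact H.1.2 s'
  have hself : V M h τ π s ≤ bellman M h τ π' (V M h τ π) s := by
    unfold bellman; rw [hs]; exact hlt.le
  have hle : ∀ s', V M h τ π s' ≤ V M h τ π' s' := by
    intro s'
    have := le_V_add M h τ hπ'.1 (W := V M h τ π) (κ := 0) (fun s' => ?_) s'
    · simpa using this
    · rw [add_zero]
      by_cases hs' : s' = s
      · subst hs'; exact hself
      · rw [← bellman_V M h τ H.1.1 s']
        unfold bellman
        rw [hne s' hs']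
  have h1 : p ⬝ᵥ Q M h τ π s ≤ p ⬝ᵥ Q M h τ π' s + 0 :=
    dotProduct_le_dotProduct_add hp fun a => by
      rw [sub_nonpos]
      exact add_le_add_right (mul_le_mul_of_nonneg_left (Finset.sum_le_sum fun s' _ =>
        mul_le_mul_of_nonneg_left (hle s') ((M.P_mem s a).1 s')) M.γ_nonneg) _
  have h2 := V_eq M h τ hπ'.1 s
  rw [hs] at h2
  linarith [H.2 π' hπ' s]

/-! ### Gain of one update, and distance between approximate minimizers. -/

/-- The gain in the regularized linear objective, as a sum of two Bregman-type remainders. -/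
lemma gain_eq {τ η x y : ℝ} (hτ : 0 < τ) (hη : 0 < η) {Q g g' p q : A → ℝ}
    (hg' : ∀ a, g' a = 1 / (1 + η * τ) * g a + η / (1 + η * τ) * Q a) :
    Q ⬝ᵥ p - τ * x - (Q ⬝ᵥ q - τ * y)
      = (1 / η + τ) * (y - x - g' ⬝ᵥ (q - p)) + 1 / η * (x - y - g ⬝ᵥ (p - q)) := by
  have hη1 : 0 < 1 + η * τ := by positivity
  have hg : ∀ v : A → ℝ, g' ⬝ᵥ v = 1 / (1 + η * τ) * (g ⬝ᵥ v) + η / (1 + η * τ) * (Q ⬝ᵥ v) := by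
    intro v
    simp only [dotProduct, hg', add_mul, Finset.sum_add_distrib, Finset.mul_sum, mul_assoc]
  rw [hg]
  simp only [dotProduct_sub]
  generalize g ⬝ᵥ p = a1
  generalize g ⬝ᵥ q = a3
  generalize Q ⬝ᵥ p = a4
  generalize Q ⬝ᵥ q = a5
  field_simp
  ring

/-- Both remainders are at least -δ with δ = η α ε; their weights 1/η + τ and 1/η turn this into -ε
and -α ε ≥ -ε. -/
lemma le_gain {h : (A → ℝ) → EReal} {τ η ε : ℝ} (hτ : 0 < τ) (hη : 0 < η) (hε : 0 ≤ ε)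
    {Q g g' p q : A → ℝ} (hg' : ∀ a, g' a = 1 / (1 + η * τ) * g a + η / (1 + η * τ) * Q a)
    (hq : IsApproxSubgradient h (η * alpha τ η * ε) q g)
    (hp : IsApproxSubgradient h (η * alpha τ η * ε) p g') :
    -(2 * ε) ≤ Q ⬝ᵥ p - τ * (h p).toReal - (Q ⬝ᵥ q - τ * (h q).toReal) := by
  rw [gain_eq hτ hη hg']
  have h1 := hq.2.2 p hp.1 hp.2.1
  have h2 := hp.2.2 q hq.1 hq.2.1
  have h3 : -(η * alpha τ η * ε) * (1 / η + τ) = -ε := by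
    have : 0 < 1 + η * τ := by positivity
    unfold alpha; field_simp
  have h4 : -(η * alpha τ η * ε) * (1 / η) = -(alpha τ η * ε) := by field_simp
  have h5 := mul_le_mul_of_nonneg_left (show -(η * alpha τ η * ε) ≤
    (h q).toReal - (h p).toReal - g' ⬝ᵥ (q - p) by linarith) (show 0 ≤ 1 / η + τ by positivity)
  have h6 := mul_le_mul_of_nonneg_left (show -(η * alpha τ η * ε) ≤
    (h p).toReal - (h q).toReal - g ⬝ᵥ (p - q) by linarith) (show 0 ≤ 1 / η by positivity)
  have h7 : alpha τ η * ε ≤ ε :=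
    mul_le_of_le_one_left hε (by linarith [one_sub_alpha_pos hτ hη])
  linarith

/-- Quadratic growth with t = 1/2 doubles the loss δ in each remainder; the square is kept only from
the remainder based at the new point `p`. -/
lemma le_gain_of_stronglyConvex {h : (A → ℝ) → EReal} {τ η ε : ℝ} (hτ : 0 < τ) (hη : 0 < η)
    (hε : 0 ≤ ε) (hbot : ∀ p, h p ≠ ⊥) (hsc : IsStronglyConvexL1 h)
    {Q g g' p q : A → ℝ} (hg' : ∀ a, g' a = 1 / (1 + η * τ) * g a + η / (1 + η * τ) * Q a)
    (hq : IsApproxSubgradient h (η * alpha τ η * ε) q g)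
    (hp : IsApproxSubgradient h (η * alpha τ η * ε) p g') :
    1 / (4 * (η * alpha τ η)) * l1norm (p - q) ^ 2 - 4 * ε
      ≤ Q ⬝ᵥ p - τ * (h p).toReal - (Q ⬝ᵥ q - τ * (h q).toReal) := by
  have hη1 : 0 < 1 + η * τ := by positivity
  rw [gain_eq hτ hη hg']
  have h1 := hq.quadratic_growth hbot hsc hp.1 hp.2.1 (t := 1 / 2) (by norm_num) (by norm_num)
  have h2 := hp.quadratic_growth hbot hsc hq.1 hq.2.1 (t := 1 / 2) (by norm_num) (by norm_num)
  rw [l1norm_sub_comm q p] at h2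
  set D1 := (h p).toReal - (h q).toReal - g ⬝ᵥ (p - q)
  set D2 := (h q).toReal - (h p).toReal - g' ⬝ᵥ (q - p)
  set n := l1norm (p - q)
  have h5 := mul_le_mul_of_nonneg_left (show n ^ 2 / 4 - 2 * (η * alpha τ η * ε) ≤ D2 by linarith)
    (show 0 ≤ 1 / η + τ by positivity)
  have h6 := mul_le_mul_of_nonneg_left (show - (2 * (η * alpha τ η * ε)) ≤ D1 by
    linarith [sq_nonneg n]) (show 0 ≤ 1 / η by positivity)
  have h3 : (1 / η + τ) * (n ^ 2 / 4 - 2 * (η * alpha τ η * ε))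
      = 1 / (4 * (η * alpha τ η)) * n ^ 2 - 2 * ε := by
    unfold alpha; field_simp
  have h4 : 1 / η * -(2 * (η * alpha τ η * ε)) = -(2 * (alpha τ η * ε)) := by field_simp
  have h7 : alpha τ η * ε ≤ ε :=
    mul_le_of_le_one_left hε (by linarith [one_sub_alpha_pos hτ hη])
  linarith

/-- Adding the quadratic growth inequalities based at `p` and at `q` leaves ⟨f - g, p - q⟩ ≤ c n on
the right, besides the error term from δ. -/
lemma dist_le_of_approxSubgradient {h : (A → ℝ) → EReal} {δ c : ℝ}
    (hbot : ∀ p, h p ≠ ⊥) (hsc : IsStronglyConvexL1 h) {p q f g : A → ℝ}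
    (hp : IsApproxSubgradient h 0 p f) (hq : IsApproxSubgradient h δ q g)
    (hfg : ∀ a, |f a - g a| ≤ c) : l1norm (p - q) ≤ c + √(2 * δ) := by
  set n := l1norm (p - q) with hn
  have hn0 : 0 ≤ n := l1norm_nonneg _
  have h0 : n ^ 2 / 2 ≤ (h q).toReal - (h p).toReal - f ⬝ᵥ (q - p) := by
    refine le_of_forall_pos_lt_add fun ε hε => ?_
    -- The subgradient at `p` is exact, so t can be sent to 0; this choice makes t n² ≤ ε.
    let t := ε / (n ^ 2 + 1 + ε)
    have hd : 0 < n ^ 2 + 1 + ε := by positivity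
    have ht0 : 0 < t := by positivity
    have ht1 : t < 1 := by rw [div_lt_one hd]; nlinarith [sq_nonneg n]
    have := hp.quadratic_growth hbot hsc hq.1 hq.2.1 ht0 ht1
    rw [l1norm_sub_comm, ← hn, zero_div, add_zero] at this
    have h2 : t * n ^ 2 ≤ ε := by
      rw [div_mul_eq_mul_div, div_le_iff₀ hd]; nlinarith [sq_nonneg n]
    linarith
  have hin : (f - g) ⬝ᵥ (p - q) ≤ c * n :=
    (le_abs_self _).trans (abs_dotProduct_le _ _ hfg)
  have hsplit : (f - g) ⬝ᵥ (p - q) = -(f ⬝ᵥ (q - p)) - g ⬝ᵥ (p - q) := by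
    simp only [dotProduct_sub, sub_dotProduct]; ring
  refine le_of_forall_gt_imp_ge_of_dense fun b hb => ?_
  -- `w` replaces √(2δ) by something strictly larger, hence positive even when δ = 0.
  set w := b - c with hw
  have hwd : √(2 * δ) < w := by linarith
  have hw0 : 0 < w := (Real.sqrt_nonneg _).trans_lt hwd
  have hδw : 2 * δ ≤ w ^ 2 := (Real.sqrt_le_left hw0.le).1 hwd.le
  by_contra! hlt
  have hA : Nonempty A := by
    by_contra hA
    rw [not_nonempty_iff] at hA
    simpa using hp.1.2
  have hc : 0 ≤ c := (abs_nonneg _).trans (hfg hA.some)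
  have hwn : w < n := by linarith
  have hnpos : 0 < n := hw0.trans hwn
  -- The loss t n²/2 + δ/t is minimal at t = √(2δ)/n, which t = w/n approximates.
  have := hq.quadratic_growth hbot hsc hp.1 hp.2.1 (t := w / n) (by positivity)
    ((div_lt_one hnpos).2 hwn)
  rw [← hn] at this
  have h3 : (1 - w / n) / 2 * n ^ 2 = n ^ 2 / 2 - w * n / 2 := by field_simp
  have h4 : δ / (w / n) ≤ w * n / 2 := by
    rw [div_div_eq_mul_div, div_le_iff₀ hw0]; nlinarith
  have h5 : n * (n - w - c) ≤ 0 := by nlinarith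
  nlinarith

/-! ### Error floors and the recursion along a run. -/

/-- The error floor when each update decreases the regularized objective by at most `κ`. -/
def errorFloor (γ τ η κ εeval εopt : ℝ) : ℝ :=
  1 / (1 - γ) * (2 * εeval + εopt + γ * κ / ((1 - γ) * (1 - alpha τ η)))

lemma errorFloor_convex (γ τ η εeval εopt : ℝ) :
    errorFloor γ τ η (2 * εeval + 2 * εopt) εeval εopt = C₂ γ τ η εeval εopt := by
  unfold errorFloor C₂
  ring

lemma errorFloor_stronglyConvex {γ τ η εeval εopt : ℝ} (hτ : 0 < τ) (hη : 0 < η) (hγ : γ < 1) :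
    errorFloor γ τ η (η * alpha τ η * εeval ^ 2 + 4 * εopt) εeval εopt
      = C₃ γ τ η εeval εopt := by
  have h1 := sub_pos.2 hγ
  have h2 := alpha_pos hτ hη
  unfold errorFloor C₃
  -- As 1 - α = τ η α, the factor η α in front of ε_eval² cancels and leaves 1/τ.
  rw [one_sub_alpha hτ hη]
  field_simp
  ring

namespace IsApproxGPMD

variable [DecidableEq S] {M : MDP S A} {h : S → (A → ℝ) → EReal} {τ η εeval εopt : ℝ}
  {π ξ Qhat : ℕ → S → A → ℝ}

lemma εeval_nonneg (H : IsApproxGPMD M h τ η εeval εopt π ξ Qhat) : 0 ≤ εeval :=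
  (norm_nonneg _).trans (H.evaluation 0)

lemma finite_iterate (H : IsApproxGPMD M h τ η εeval εopt π ξ Qhat)
    (hτ : 0 < τ) (hη : 0 < η) (hbot : ∀ s p, h s p ≠ ⊥) (k : ℕ) (s : S) :
    π k s ∈ stdSimplex ℝ A ∧ h s (π k s) ≠ ⊤ := by
  induction k with
  | zero => exact ⟨H.init_policy s, (H.init_subgradient s).1⟩
  | succ k ih =>
    have := ((H.policy_update k s).isApproxSubgradient hτ hη (hbot s) ih.1 ih.2
      (H.subgradient_update k s)).2
    exact ⟨this.1, this.2.1⟩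

lemma εopt_nonneg [Nonempty S] (H : IsApproxGPMD M h τ η εeval εopt π ξ Qhat)
    (hτ : 0 < τ) (hη : 0 < η) (hbot : ∀ s p, h s p ≠ ⊥) : 0 ≤ εopt := by
  obtain ⟨s⟩ := ‹Nonempty S›
  exact ((H.policy_update 0 s).isApproxSubgradient hτ hη (hbot s) (H.init_policy s)
    (H.init_subgradient s).1 (H.subgradient_update 0 s)).1

lemma isApproxSubgradient [Nonempty S] (H : IsApproxGPMD M h τ η εeval εopt π ξ Qhat)
    (hτ : 0 < τ) (hη : 0 < η) (hbot : ∀ s p, h s p ≠ ⊥) (k : ℕ) (s : S) :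
    IsApproxSubgradient (h s) (η * alpha τ η * εopt) (π k s) (ξ k s) := by
  cases k with
  | zero =>
    refine (isApproxSubgradient_of_mem_subdifferential (hbot s) (H.init_policy s)
      (H.init_subgradient s)).mono ?_
    have := alpha_pos hτ hη
    have := H.εopt_nonneg hτ hη hbot
    positivity
  | succ k =>
    have hk := H.finite_iterate hτ hη hbot k s
    exact ((H.policy_update k s).isApproxSubgradient hτ hη (hbot s) hk.1 hk.2
      (H.subgradient_update k s)).2

/-- This exhibits τ ξ as a running weighted average of the Q-estimates. -/
lemma scaled_update (H : IsApproxGPMD M h τ η εeval εopt π ξ Qhat) (hτ : 0 < τ) (hη : 0 < η)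
    (k : ℕ) (s : S) (a : A) : τ * ξ (k + 1) s a
      = alpha τ η * (τ * ξ k s a) + (1 - alpha τ η) * Qhat k s a := by
  rw [H.subgradient_update, one_sub_alpha hτ hη]
  unfold alpha
  ring

lemma abs_evaluation (H : IsApproxGPMD M h τ η εeval εopt π ξ Qhat) (k : ℕ) (s : S) (a : A) :
    |Qhat k s a - Q M h τ (π k) s a| ≤ εeval :=
  (abs_le_norm (Qhat k - Q M h τ (π k)) s a).trans (H.evaluation k)

lemma norm_Qstar_sub_update_le (H : IsApproxGPMD M h τ η εeval εopt π ξ Qhat)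
    (hτ : 0 < τ) (hη : 0 < η) (k : ℕ) :
    ‖Qstar M h τ - τ • ξ (k + 1)‖ ≤ alpha τ η * ‖Qstar M h τ - τ • ξ k‖
      + (1 - alpha τ η) * ‖Qstar M h τ - Q M h τ (π k)‖ + (1 - alpha τ η) * εeval := by
  have h1 := (alpha_pos hτ hη).le
  have h2 := (one_sub_alpha_pos hτ hη).le
  have heq : Qstar M h τ - τ • ξ (k + 1) = alpha τ η • (Qstar M h τ - τ • ξ k)
      + (1 - alpha τ η) • (Qstar M h τ - Q M h τ (π k))
      - (1 - alpha τ η) • (Qhat k - Q M h τ (π k)) := by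
    funext s a
    have := H.scaled_update hτ hη k s a
    simp only [Pi.sub_apply, Pi.add_apply, Pi.smul_apply, smul_eq_mul]
    linarith
  rw [heq]
  refine (norm_sub_le _ _).trans (add_le_add ((norm_add_le _ _).trans_eq ?_) ?_)
  · rw [norm_smul, norm_smul, Real.norm_of_nonneg h1, Real.norm_of_nonneg h2]
  · rw [norm_smul, Real.norm_of_nonneg h2]
    exact mul_le_mul_of_nonneg_left (H.evaluation k) h2

/-- The gain of an update with respect to the exact Q-function. -/
lemma gain_evaluation_error (H : IsApproxGPMD M h τ η εeval εopt π ξ Qhat) (k : ℕ) (s : S)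
    (p q : A → ℝ) :
    Qhat k s ⬝ᵥ p - Qhat k s ⬝ᵥ q - εeval * l1norm (p - q)
      ≤ p ⬝ᵥ Q M h τ (π k) s - q ⬝ᵥ Q M h τ (π k) s := by
  have h1 := (le_abs_self _).trans
    (abs_dotProduct_le (Qhat k s - Q M h τ (π k) s) (p - q) (H.abs_evaluation k s))
  rw [sub_dotProduct, dotProduct_sub, dotProduct_sub] at h1
  rw [dotProduct_comm p, dotProduct_comm q]
  linarith

/-- The ℓ¹ diameter 2 of the simplex produces 2 ε_eval; the inexact subgradients produce 2 ε_opt. -/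
lemma V_le_bellman_add [Nonempty S] (H : IsApproxGPMD M h τ η εeval εopt π ξ Qhat)
    (hτ : 0 < τ) (hη : 0 < η) (hbot : ∀ s p, h s p ≠ ⊥) (k : ℕ) (s : S) :
    V M h τ (π k) s ≤ bellman M h τ (π (k + 1)) (V M h τ (π k)) s
      + (2 * εeval + 2 * εopt) := by
  have hsub := H.isApproxSubgradient hτ hη hbot
  rw [V_eq M h τ fun s => (hsub k s).1]
  change _ ≤ π (k + 1) s ⬝ᵥ Q M h τ (π k) s - _ + _
  have h1 := H.gain_evaluation_error k s (π (k + 1) s) (π k s)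
  have h2 := mul_le_mul_of_nonneg_left
    (l1norm_sub_le_two (hsub (k + 1) s).1 (hsub k s).1) H.εeval_nonneg
  have h3 := le_gain hτ hη (H.εopt_nonneg hτ hη hbot) (H.subgradient_update k s) (hsub k s)
    (hsub (k + 1) s)
  linarith

lemma V_le_bellman_add_of_stronglyConvex [Nonempty S]
    (H : IsApproxGPMD M h τ η εeval εopt π ξ Qhat) (hτ : 0 < τ) (hη : 0 < η)
    (hbot : ∀ s p, h s p ≠ ⊥) (hsc : ∀ s, IsStronglyConvexL1 (h s)) (k : ℕ) (s : S) :
    V M h τ (π k) s ≤ bellman M h τ (π (k + 1)) (V M h τ (π k)) s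
      + (η * alpha τ η * εeval ^ 2 + 4 * εopt) := by
  have hsub := H.isApproxSubgradient hτ hη hbot
  rw [V_eq M h τ fun s => (hsub k s).1]
  change _ ≤ π (k + 1) s ⬝ᵥ Q M h τ (π k) s - _ + _
  have h1 := H.gain_evaluation_error k s (π (k + 1) s) (π k s)
  have h3 := le_gain_of_stronglyConvex hτ hη (H.εopt_nonneg hτ hη hbot) (hbot s) (hsc s)
    (H.subgradient_update k s) (hsub k s) (hsub (k + 1) s)
  set n := l1norm (π (k + 1) s - π k s)
  have hc : 0 < η * alpha τ η := mul_pos hη (alpha_pos hτ hη)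
  -- Completing the square: the quadratic gain pays for the linear evaluation error.
  have h4 : 0 ≤ 1 / (4 * (η * alpha τ η)) * n ^ 2 - εeval * n + η * alpha τ η * εeval ^ 2 := by
    generalize η * alpha τ η = c at hc
    have : 1 / (4 * c) * n ^ 2 - εeval * n + c * εeval ^ 2 = (n - 2 * c * εeval) ^ 2 / (4 * c) := by
      field_simp; ring
    rw [this]; positivity
  linarith

/-- Along the run, `τ ξ - Q` stays bounded above. -/
lemma scaled_sub_Q_le {κ d : ℝ} (H : IsApproxGPMD M h τ η εeval εopt π ξ Qhat)
    (hτ : 0 < τ) (hη : 0 < η) {k : ℕ} (hpol : IsPolicy (π (k + 1)))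
    (hκ : ∀ s, V M h τ (π k) s ≤ bellman M h τ (π (k + 1)) (V M h τ (π k)) s + κ)
    (hd : ∀ s a, τ * ξ k s a - Q M h τ (π k) s a ≤ d) (s : S) (a : A) :
    τ * ξ (k + 1) s a - Q M h τ (π (k + 1)) s a
      ≤ alpha τ η * d + (1 - alpha τ η) * εeval + M.γ * (κ / (1 - M.γ)) := by
  have h1 : Q M h τ (π k) s a - Q M h τ (π (k + 1)) s a ≤ M.γ * (κ / (1 - M.γ)) := by
    have : Q M h τ (π k) s a - Q M h τ (π (k + 1)) s a
        = M.γ * ∑ s', M.P s a s' * (V M h τ (π k) s' - V M h τ (π (k + 1)) s') := by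
      simp only [Q, mul_sub, Finset.sum_sub_distrib]
      ring
    rw [this]
    exact mul_le_mul_of_nonneg_left (sum_mul_le_of_mem_stdSimplex (M.P_mem s a) fun s' =>
      sub_le_iff_le_add'.2 (le_V_add M h τ hpol hκ s')) M.γ_nonneg
  have h2 := mul_le_mul_of_nonneg_left (hd s a) (alpha_pos hτ hη).le
  have h3 := mul_le_mul_of_nonneg_left (abs_le.1 (H.abs_evaluation k s a)).2
    (one_sub_alpha_pos hτ hη).le
  rw [H.scaled_update hτ hη]
  linarith

/-- The induction carries a one-sided bound `d` along with the norm, because only their sum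
contracts. -/
theorem error_bound [Nonempty S] (H : IsApproxGPMD M h τ η εeval εopt π ξ Qhat)
    (hτ : 0 < τ) (hη : 0 < η) (hbot : ∀ s p, h s p ≠ ⊥) {κ : ℝ} (hκ0 : 0 ≤ κ)
    (hκ : ∀ k s, V M h τ (π k) s ≤ bellman M h τ (π (k + 1)) (V M h τ (π k)) s + κ) (k : ℕ) :
    ∃ d, 0 ≤ d ∧ (∀ s a, τ * ξ (k + 1) s a - Q M h τ (π (k + 1)) s a ≤ d) ∧
      ‖Qstar M h τ - τ • ξ (k + 1)‖ + d + (1 - alpha τ η) * εopt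
        ≤ rate M τ η ^ k * C₁ M h τ η (π 0) (ξ 0) + errorFloor M.γ τ η κ εeval εopt := by
  have hsub := H.isApproxSubgradient hτ hη hbot
  have hbdd := bddAbove_values M hτ (hsub 0)
  have hγ0 := M.γ_nonneg
  have hγ := sub_pos.2 M.γ_lt_one
  have hα := alpha_pos hτ hη
  have hα1 := one_sub_alpha_pos hτ hη
  have hev := H.εeval_nonneg
  have hop := H.εopt_nonneg hτ hη hbot
  set K := errorFloor M.γ τ η κ εeval εopt with hKdef
  -- `K` is the fixed point of the affine recursion y ↦ rate · y + right-hand side.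
  have hK : (1 - M.γ) * (1 - alpha τ η) * K
      = (1 - alpha τ η) * (2 * εeval + εopt) + M.γ * (κ / (1 - M.γ)) := by
    rw [hKdef, errorFloor]; field_simp
  have he : 0 ≤ M.γ * (κ / (1 - M.γ)) := by positivity
  have hK0 : 0 ≤ K := by rw [hKdef, errorFloor]; positivity
  have hop' : (1 - alpha τ η) * ((1 - alpha τ η) * εopt) ≤ (1 - alpha τ η) * εopt :=
    mul_le_mul_of_nonneg_left (mul_le_of_le_one_left hop (by linarith)) hα1.le
  induction k with
  | zero =>
    refine ⟨_, by positivity, H.scaled_sub_Q_le hτ hη (fun s => (hsub 1 s).1) (hκ 0)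
      -- With this d_0, the terms α d_0 + α x_0 + (1-α) ‖Q* - Q^{(0)}‖ add up exactly to `C₁`.
      (d := ‖Qstar M h τ - Q M h τ (π 0)‖ + ‖Qstar M h τ - τ • ξ 0‖) fun s a => ?_, ?_⟩
    · have h1 := (le_abs_self _).trans (abs_le_norm (Qstar M h τ - Q M h τ (π 0)) s a)
      have h2 := (neg_le_abs _).trans (abs_le_norm (Qstar M h τ - τ • ξ 0) s a)
      simp only [Pi.sub_apply, Pi.smul_apply, smul_eq_mul] at h1 h2
      linarith
    · have h1 := H.norm_Qstar_sub_update_le hτ hη 0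
      have h2 : (1 - M.γ) * (1 - alpha τ η) * K ≤ (1 - alpha τ η) * K :=
        mul_le_mul_of_nonneg_right (mul_le_of_le_one_left hα1.le (by linarith)) hK0
      have h3 : (1 - alpha τ η) * K ≤ K := mul_le_of_le_one_left hK0 (by linarith)
      rw [pow_zero, one_mul, C₁]
      linarith
  | succ k ih =>
    obtain ⟨d, hd0, hd, hy⟩ := ih
    refine ⟨_, by positivity,
      H.scaled_sub_Q_le hτ hη (fun s => (hsub (k + 2) s).1) (hκ (k + 1)) hd, ?_⟩
    have h1 := H.norm_Qstar_sub_update_le hτ hη (k + 1)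
    have h2 := norm_Qstar_sub_Q_le hbdd
      ⟨fun s => (hsub (k + 1) s).1, fun s => (hsub (k + 1) s).2.1⟩
      (Vstar_sub_V_le hτ hbdd (hsub (k + 1)) hd)
    rw [← mul_assoc, ← one_sub_alpha hτ hη] at h2
    set R := rate M τ η ^ k * C₁ M h τ η (π 0) (ξ 0)
    have hR : rate M τ η ^ (k + 1) * C₁ M h τ η (π 0) (ξ 0) = rate M τ η * R := by
      rw [pow_succ']; ring
    have h3 := mul_le_mul_of_nonneg_left (h2.trans (mul_le_mul_of_nonneg_left hy hγ0)) hα1.le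
    have h4 := mul_le_mul_of_nonneg_left hy hα.le
    have h5 : rate M τ η * (R + K)
        = alpha τ η * (R + K) + (1 - alpha τ η) * (M.γ * (R + K)) := by
      unfold rate; ring
    have h6 : rate M τ η * K = K - (1 - M.γ) * (1 - alpha τ η) * K := by
      unfold rate; ring
    rw [hR]
    linarith

theorem bounds [Nonempty S] (H : IsApproxGPMD M h τ η εeval εopt π ξ Qhat)
    (hτ : 0 < τ) (hη : 0 < η) (hbot : ∀ s p, h s p ≠ ⊥) {κ : ℝ} (hκ0 : 0 ≤ κ)
    (hκ : ∀ k s, V M h τ (π k) s ≤ bellman M h τ (π (k + 1)) (V M h τ (π k)) s + κ) (k : ℕ) :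
    ‖Qstar M h τ - Q M h τ (π (k + 1))‖
        ≤ M.γ * (rate M τ η ^ k * C₁ M h τ η (π 0) (ξ 0) + errorFloor M.γ τ η κ εeval εopt) ∧
    ‖Vstar M h τ - V M h τ (π (k + 1))‖ ≤ (M.γ + 2) *
        (rate M τ η ^ k * C₁ M h τ η (π 0) (ξ 0) + errorFloor M.γ τ η κ εeval εopt)
          + (1 - alpha τ η) * εopt ∧
    ‖Qstar M h τ - τ • ξ (k + 1)‖
        ≤ rate M τ η ^ k * C₁ M h τ η (π 0) (ξ 0) + errorFloor M.γ τ η κ εeval εopt := by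
  have hsub := H.isApproxSubgradient hτ hη hbot
  have hbdd := bddAbove_values M hτ (hsub 0)
  have hadm : Admissible h (π (k + 1)) :=
    ⟨fun s => (hsub (k + 1) s).1, fun s => (hsub (k + 1) s).2.1⟩
  obtain ⟨d, hd0, hd, hy⟩ := H.error_bound hτ hη hbot hκ0 hκ k
  set B := rate M τ η ^ k * C₁ M h τ η (π 0) (ξ 0) + errorFloor M.γ τ η κ εeval εopt
  have hV : ∀ s, Vstar M h τ s - V M h τ (π (k + 1)) s ≤ B := fun s => by
    have := Vstar_sub_V_le hτ hbdd (hsub (k + 1)) hd s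
    rw [← mul_assoc, ← one_sub_alpha hτ hη] at this
    exact this.trans hy
  have hVn := norm_Vstar_sub_V_le hbdd hadm hV
  have hB := (norm_nonneg _).trans hVn
  have hop := mul_nonneg (one_sub_alpha_pos hτ hη).le (H.εopt_nonneg hτ hη hbot)
  refine ⟨norm_Qstar_sub_Q_le hbdd hadm hV, ?_, ?_⟩
  -- The value gap is already at most `B`; the factor γ + 2 is slack.
  · have := mul_nonneg M.γ_nonneg hB
    linarith
  · linarith

/-- Greediness of π* makes Q*/τ an exact subgradient at π* over the simplex, while ξ^{(k)} is a
δ-subgradient at π^{(k)}. -/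
theorem policy_bound [Nonempty S] (H : IsApproxGPMD M h τ η εeval εopt π ξ Qhat)
    (hτ : 0 < τ) (hη : 0 < η) (hbot : ∀ s p, h s p ≠ ⊥) (hsc : ∀ s, IsStronglyConvexL1 (h s))
    {πstar : S → A → ℝ} (hopt : IsOptimal M h τ πstar) (k : ℕ) (s : S) :
    l1norm (πstar s - π k s)
      ≤ τ⁻¹ * ‖Qstar M h τ - τ • ξ k‖ + √(2 * η * εopt / (1 + η * τ)) := by
  have hop := H.εopt_nonneg hτ hη hbot
  have hα := alpha_pos hτ hη
  have hstar : IsApproxSubgradient (h s) 0 (πstar s) (τ⁻¹ • Qstar M h τ s) := by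
    refine ⟨hopt.1.1 s, hopt.1.2 s, fun p hp hpt => ?_⟩
    have h1 := mul_le_mul_of_nonneg_left (hopt.greedy hp hpt) (inv_nonneg.2 hτ.le)
    rw [smul_dotProduct, dotProduct_comm, sub_dotProduct, smul_eq_mul]
    simp only [mul_sub, inv_mul_cancel_left₀ hτ.ne'] at h1 ⊢
    linarith
  have hdist := dist_le_of_approxSubgradient (hbot s) (hsc s) hstar
    (H.isApproxSubgradient hτ hη hbot k s) (c := τ⁻¹ * ‖Qstar M h τ - τ • ξ k‖) fun a => by
      have h1 := abs_le_norm (Qstar M h τ - τ • ξ k) s a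
      have h2 : (τ⁻¹ • Qstar M h τ s) a - ξ k s a = τ⁻¹ * (Qstar M h τ - τ • ξ k) s a := by
        simp only [Pi.sub_apply, Pi.smul_apply, smul_eq_mul]
        field_simp
      rw [h2, abs_mul, abs_of_pos (inv_pos.2 hτ)]
      exact mul_le_mul_of_nonneg_left h1 (inv_nonneg.2 hτ.le)
  have hδ : 2 * (η * alpha τ η * εopt) = 2 * η * εopt / (1 + η * τ) := by
    unfold alpha; ring
  rwa [hδ] at hdist

end IsApproxGPMD

end GPMD

end

open GPMD in
theorem theorem2 {S A : Type*} [Fintype S] [DecidableEq S] [Nonempty S] [Fintype A]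
    (M : MDP S A) (h : S → (A → ℝ) → EReal) (ζ : ℝ) (hζ : 0 < ζ)
    (hreg : ∀ s, IsRegularizer ζ (h s))
    (τ η : ℝ) (hτ : 0 < τ) (hη : 0 < η) (εeval εopt : ℝ)
    (π ξ Qhat : ℕ → S → A → ℝ) (hrun : IsApproxGPMD M h τ η εeval εopt π ξ Qhat) :
    (∀ k : ℕ,
      ‖Qstar M h τ - Q M h τ (π (k + 1))‖
        ≤ M.γ * (rate M τ η ^ k * C₁ M h τ η (π 0) (ξ 0) + C₂ M.γ τ η εeval εopt) ∧
      ‖Vstar M h τ - V M h τ (π (k + 1))‖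
        ≤ (M.γ + 2) * (rate M τ η ^ k * C₁ M h τ η (π 0) (ξ 0) + C₂ M.γ τ η εeval εopt)
          + (1 - alpha τ η) * εopt) ∧
    ((∀ s, IsStronglyConvexL1 (h s)) → ∀ k : ℕ,
      ‖Qstar M h τ - Q M h τ (π (k + 1))‖
        ≤ M.γ * (rate M τ η ^ k * C₁ M h τ η (π 0) (ξ 0) + C₃ M.γ τ η εeval εopt) ∧
      ‖Vstar M h τ - V M h τ (π (k + 1))‖
        ≤ (M.γ + 2) * (rate M τ η ^ k * C₁ M h τ η (π 0) (ξ 0) + C₃ M.γ τ η εeval εopt)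
          + (1 - alpha τ η) * εopt ∧
      ∀ πstar : S → A → ℝ, IsOptimal M h τ πstar → ∀ s,
        l1norm (πstar s - π (k + 1) s)
          ≤ τ⁻¹ * (rate M τ η ^ k * C₁ M h τ η (π 0) (ξ 0) + C₃ M.γ τ η εeval εopt)
            + √(2 * η * εopt / (1 + η * τ))) := by
  have hbot : ∀ s p, h s p ≠ ⊥ := fun s => (hreg s).ne_bot
  have hev := hrun.εeval_nonneg
  have hop := hrun.εopt_nonneg hτ hη hbot
  have hα := alpha_pos hτ hη
  refine ⟨fun k => ?_, fun hsc k => ?_⟩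
  · have hb := hrun.bounds hτ hη hbot (by positivity) (hrun.V_le_bellman_add hτ hη hbot) k
    rw [errorFloor_convex] at hb
    exact ⟨hb.1, hb.2.1⟩
  · have hb := hrun.bounds hτ hη hbot (by positivity)
      (hrun.V_le_bellman_add_of_stronglyConvex hτ hη hbot hsc) k
    rw [errorFloor_stronglyConvex hτ hη M.γ_lt_one] at hb
    refine ⟨hb.1, hb.2.1, fun πstar hopt s => ?_⟩
    refine (hrun.policy_bound hτ hη hbot hsc hopt (k + 1) s).trans ?_
    gcongr
    exact hb.2.2
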